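/- Let $0<\epsilon\le 1$ and let $d$ be a positive integer with $d\ge 10/\epsilon$. Let $n$ and $d_A$ be integers obtained by rounding (up or down) $$\frac{120\ln 2}{\epsilon^3}\,d\log_2 d\qquad\text{and}\qquad \frac{112\ln 2}{\epsilon^2}\,d\log_2 d ,$$ respectively, and let $\mathcal H_A=\mathbb C^{d_A}$, $\mathcal H_B=\mathbb C^{d}$. Then there exist linear isometries $U_1,\dots,U_n:\mathbb C^{d^2}\to\mathcal H_A\otimes\mathcal H_B$ such that for every unit vector $|\psi\rangle\in\mathbb C^{d^2}$ $$\frac1n\,\#\Bigl\{k\in\{1,\dots,n\} : \bigl\|\operatorname{Tr}_A U_k|\psi\rangle\langle\psi|U_k^\dagger\bigr\|_\infty<\frac{1+\epsilon}{d}\Bigr\}\;\ge\;1-\epsilon ,$$ where $\operatorname{Tr}_A$ is the partial trace over $\mathcal H_A$ and $\|\cdot\|_\infty$ is the operator norm. The isometries do not depend on $\psi$. -/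

import Mathlib

noncomputable section

/-- The pure state `|ψ⟩⟨ψ|` of a vector `ψ`, as an operator. -/
def pureState {ι : Type*} [Fintype ι] (ψ : EuclideanSpace ℂ ι) :
    EuclideanSpace ℂ ι →L[ℂ] EuclideanSpace ℂ ι :=
  InnerProductSpace.rankOne ℂ ψ ψ

/-- The partial trace `Tr_A T` of an operator `T` on `ℂ^a ⊗ ℂ^b`. The tensor product is realised as
`ℂ^(a × b)`, the standard basis vector at `(i, j)` being `|i⟩_A |j⟩_B`. The operator `Tr_A T` on
`ℂ^b` has the matrix entries `⟨j| Tr_A T |j'⟩ = ∑ i, ⟨i j| T |i j'⟩`. -/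
def partialTraceA {a b : Type*} [Fintype a] [Fintype b] [DecidableEq a] [DecidableEq b]
    (T : EuclideanSpace ℂ (a × b) →L[ℂ] EuclideanSpace ℂ (a × b)) :
    EuclideanSpace ℂ b →L[ℂ] EuclideanSpace ℂ b :=
  Matrix.toEuclideanCLM (𝕜 := ℂ)
    (Matrix.of fun j j' : b => ∑ i : a, T (EuclideanSpace.single (i, j') 1) (i, j))

/-- The conjugation `U T U†` of an operator `T` by an isometry `U`. -/
def conjIsometry {ι κ : Type*} [Fintype ι] [Fintype κ]
    (U : EuclideanSpace ℂ ι →ₗᵢ[ℂ] EuclideanSpace ℂ κ)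
    (T : EuclideanSpace ℂ ι →L[ℂ] EuclideanSpace ℂ ι) :
    EuclideanSpace ℂ κ →L[ℂ] EuclideanSpace ℂ κ :=
  U.toContinuousLinearMap ∘L T ∘L ContinuousLinearMap.adjoint U.toContinuousLinearMap

end

/-! The norm of `Tr_A |y⟩⟨y|` is the largest squared length of a contraction of `y` against a unit
vector `φ` of `ℂ^d`. Embed `ℂ^(d²)` by a fixed isometry and apply independent Haar random unitaries.
For fixed nonzero `ψ` and `φ`, a Gaussian Chernoff bound shows that the contraction exceeds `(1 +
ε/2)/d` times `‖φ‖²‖ψ‖²` with probability at most `exp(-d_A ε²/12)`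
(`exists_unitary_distribution_tensorContract`). A union bound over a net of at most `d^(6d)` vectors
`φ` makes a unitary bad for `ψ` with probability at most `d^(-2d)`.

One unitary cannot serve all `ψ`, since a net for `ψ` needs up to `d^(10d²)` points. But `n` samples
can: weighting every bad sample by `d^(2d)`, the first moment gives samples for which each net point
has `c` bad indices with `d^(2dc) ≤ 2^n d^(10d²)` (`exists_forall_pow_card_le`), and this forces `c
≤ εn`. The slack between `ε/2` and `ε` pays for passing from the nets to all vectors
(`net_bound_sq_lt`). -/

open MeasureTheory Set Module
open scoped ENNReal NNReal

/-! ### Haar random unitaries and Gaussian vectors -/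

section UnitaryOrbits

variable {E : Type*} [NormedAddCommGroup E] [InnerProductSpace ℂ E] [FiniteDimensional ℂ E]

/-- The unitary group acts transitively on spheres. -/
theorem exists_linearIsometryEquiv_apply_eq {x y : E} (h : ‖x‖ = ‖y‖) :
    ∃ L : E ≃ₗᵢ[ℂ] E, L x = y := by
  rcases eq_or_ne x 0 with rfl | hx
  · refine ⟨LinearIsometryEquiv.refl ℂ E, ?_⟩
    have : ‖y‖ = 0 := by rw [← h, norm_zero]
    simp [norm_eq_zero.1 this]
  have hx' : (‖x‖ : ℂ) ≠ 0 := by simpa using hx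
  have hy : y ≠ 0 := by rw [← norm_ne_zero_iff, ← h]; simpa using hx
  let u : E := (‖x‖ : ℂ)⁻¹ • x
  let v : E := (‖x‖ : ℂ)⁻¹ • y
  have hu : ‖u‖ = 1 := by simp [u, norm_smul, hx]
  have hv : ‖v‖ = 1 := by simp [v, norm_smul, h, hy]
  let f : (ℂ ∙ u) →ₗᵢ[ℂ] E :=
    (ℂ ∙ v).subtypeₗᵢ.comp
      ((LinearIsometryEquiv.toSpanUnitSingleton u hu).symm.trans
        (LinearIsometryEquiv.toSpanUnitSingleton v hv)).toLinearIsometry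
  have hfu : f ⟨u, Submodule.mem_span_singleton_self u⟩ = v := by
    have : (LinearIsometryEquiv.toSpanUnitSingleton u hu).symm
        ⟨u, Submodule.mem_span_singleton_self u⟩ = (1 : ℂ) := by
      rw [LinearIsometryEquiv.symm_apply_eq]
      ext
      simp
    simp [f, this]
  refine ⟨f.extend.toLinearIsometryEquiv rfl, ?_⟩
  have hxu : x = (‖x‖ : ℂ) • u := by simp [u, smul_smul, hx']
  have hyv : y = (‖x‖ : ℂ) • v := by simp [v, smul_smul, hx']
  have : f.extend u = v := by
    rw [← hfu]
    exact f.extend_apply ⟨u, Submodule.mem_span_singleton_self u⟩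
  rw [LinearIsometry.coe_toLinearIsometryEquiv]
  conv_lhs => rw [hxu]
  rw [map_smul, this, ← hyv]

theorem compactSpace_unitary : CompactSpace (unitary (E →L[ℂ] E)) := by
  refine (isCompact_iff_compactSpace (s := (unitary (E →L[ℂ] E) : Set (E →L[ℂ] E)))).1 ?_
  refine Metric.isCompact_of_isClosed_isBounded isClosed_unitary ?_
  refine (Metric.isBounded_closedBall (x := (0 : E →L[ℂ] E)) (r := 1)).subset fun U hU => ?_
  rw [mem_closedBall_zero_iff]
  refine ContinuousLinearMap.opNorm_le_bound _ zero_le_one fun x => ?_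
  have := (Unitary.linearIsometryEquiv ⟨U, hU⟩).norm_map x
  rw [one_mul]
  exact this.le

variable [MeasurableSpace E] [BorelSpace E]

/-- By uniqueness of Haar measure the image of `ν` is a multiple of `ν`; the unit ball is mapped to
itself, so the factor is 1. -/
theorem LinearIsometryEquiv.measurePreserving_addHaar (ν : Measure E) [ν.IsAddHaarMeasure]
    (L : E ≃ₗᵢ[ℂ] E) : MeasurePreserving L ν ν := by
  refine ⟨L.continuous.measurable, ?_⟩
  have hmap : (ν.map L).IsAddHaarMeasure :=
    L.toContinuousLinearEquiv.isAddHaarMeasure_map ν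
  have hsm := Measure.isAddLeftInvariant_eq_smul (ν.map L) ν
  set c := (ν.map L).addHaarScalarFactor ν
  have hball : (ν.map L) (Metric.ball 0 1) = ν (Metric.ball 0 1) := by
    rw [Measure.map_apply L.continuous.measurable measurableSet_ball]
    congr 1
    ext x
    simp
  have h1 := hball
  rw [hsm, Measure.smul_apply] at h1
  have hpos := (Metric.measure_ball_pos ν (0 : E) one_pos).ne'
  have hfin := (measure_ball_lt_top (μ := ν) (x := (0 : E)) (r := 1)).ne
  have hc : (c : ℝ≥0∞) = 1 := by
    have h2 : (c : ℝ≥0∞) * ν (Metric.ball 0 1) = 1 * ν (Metric.ball 0 1) := by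
      rw [one_mul]; exact h1
    exact (ENNReal.mul_left_inj hpos hfin).1 h2
  have hc' : c = 1 := by exact_mod_cast hc
  rw [hsm, hc', one_smul]

/-- There is a probability distribution on the unitary group under which the image of every nonzero
vector is distributed like a Gaussian vector, as far as cones are concerned. -/
theorem exists_unitary_distribution (ν : Measure E) [ν.IsAddHaarMeasure] :
    ∃ (_ : MeasurableSpace (unitary (E →L[ℂ] E))) (_ : BorelSpace (unitary (E →L[ℂ] E)))
      (P : Measure (unitary (E →L[ℂ] E))),
      IsProbabilityMeasure P ∧ ∀ S : Set E, MeasurableSet S →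
        (∀ (c : ℂ) (y : E), c ≠ 0 → (c • y ∈ S ↔ y ∈ S)) → ∀ x : E, x ≠ 0 →
          P {U | (U : E →L[ℂ] E) x ∈ S} * ∫⁻ y, ENNReal.ofReal (Real.exp (-‖y‖ ^ 2)) ∂ν
            = ∫⁻ y in S, ENNReal.ofReal (Real.exp (-‖y‖ ^ 2)) ∂ν := by
  let m : MeasurableSpace (unitary (E →L[ℂ] E)) := borel _
  have hB : BorelSpace (unitary (E →L[ℂ] E)) := ⟨rfl⟩
  have hC := compactSpace_unitary (E := E)
  let Q : Measure (unitary (E →L[ℂ] E)) := Measure.haarMeasure ⊤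
  have hQ : IsProbabilityMeasure Q := ⟨by
    simpa using Measure.haarMeasure_self (K₀ := (⊤ : TopologicalSpace.PositiveCompacts
      (unitary (E →L[ℂ] E))))⟩
  -- Haar measure is left invariant; inversion makes it right invariant, which allows `x` to be
  -- replaced by `V x` in `U x`.
  let P := Q.map Inv.inv
  have hP : IsProbabilityMeasure P := Measure.isProbabilityMeasure_map measurable_inv.aemeasurable
  have hPinv : ∀ V : unitary (E →L[ℂ] E), MeasurePreserving (fun U => U * V) P P := fun V => by
    refine ⟨measurable_mul_const V, ?_⟩
    rw [Measure.map_map (measurable_mul_const V) measurable_inv]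
    have : (fun U : unitary (E →L[ℂ] E) => U * V) ∘ Inv.inv
        = Inv.inv ∘ fun U => V⁻¹ * U := by
      ext1 U; simp
    rw [this, ← Measure.map_map measurable_inv (measurable_const_mul _),
      map_mul_left_eq_self]
  refine ⟨m, hB, P, hP, fun S hS hcone x hx => ?_⟩
  have hev : Continuous fun p : unitary (E →L[ℂ] E) × E => (p.1 : E →L[ℂ] E) p.2 :=
    (continuous_subtype_val.comp continuous_fst).clm_apply continuous_snd
  have hmeas : MeasurableSet {p : unitary (E →L[ℂ] E) × E | (p.1 : E →L[ℂ] E) p.2 ∈ S} :=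
    hev.measurable hS
  have hslice : ∀ y : E, MeasurableSet {U : unitary (E →L[ℂ] E) | (U : E →L[ℂ] E) y ∈ S} :=
    fun y => measurable_prodMk_right hmeas
  have hconst : ∀ y : E, y ≠ 0 →
      P {U | (U : E →L[ℂ] E) y ∈ S} = P {U | (U : E →L[ℂ] E) x ∈ S} := fun y hy => by
    have hx' : ‖x‖ ≠ 0 := norm_ne_zero_iff.2 hx
    have hy' : ‖y‖ ≠ 0 := norm_ne_zero_iff.2 hy
    have hc : ((‖y‖ : ℂ) * (‖x‖ : ℂ)⁻¹) ≠ 0 := by simp [hx, hy]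
    obtain ⟨L, hL⟩ := exists_linearIsometryEquiv_apply_eq
      (x := ((‖y‖ : ℂ) * (‖x‖ : ℂ)⁻¹) • x) (y := y) (by simp [norm_smul, hx'])
    let V := Unitary.linearIsometryEquiv.symm L
    have hV : ∀ z, (V : E →L[ℂ] E) z = L z := fun z => rfl
    rw [← (hPinv V).measure_preimage (hslice x).nullMeasurableSet]
    congr 1
    ext U
    simp only [mem_ofPred_eq, mem_preimage, Submonoid.coe_mul, mul_apply_eq_comp, hV]
    rw [← hL, map_smul, map_smul, hcone _ _ hc]
  have hw : Measurable fun y : E => ENNReal.ofReal (Real.exp (-‖y‖ ^ 2)) := by fun_prop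
  have hν0 : ∀ᵐ y ∂ν, y ≠ 0 := by
    have : Nontrivial E := ⟨x, 0, hx⟩
    have : (nhdsWithin (0 : E) {0}ᶜ).NeBot := Module.punctured_nhds_neBot ℂ E 0
    exact compl_mem_ae_iff.2 (measure_singleton (0 : E))
  -- The probability does not depend on the nonzero vector, so it may be averaged over a Gaussian
  -- `y`. After exchanging the integrals, each fixed `U` preserves the Gaussian weight.
  calc P {U | (U : E →L[ℂ] E) x ∈ S} * ∫⁻ y, ENNReal.ofReal (Real.exp (-‖y‖ ^ 2)) ∂ν
      = ∫⁻ y, P {U | (U : E →L[ℂ] E) y ∈ S} * ENNReal.ofReal (Real.exp (-‖y‖ ^ 2)) ∂ν := by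
        rw [← lintegral_const_mul _ hw]
        exact lintegral_congr_ae (hν0.mono fun y hy => by simp only [hconst y hy])
    _ = ∫⁻ y, ∫⁻ U, S.indicator 1 ((U : E →L[ℂ] E) y)
          * ENNReal.ofReal (Real.exp (-‖y‖ ^ 2)) ∂P ∂ν := by
        refine lintegral_congr fun y => ?_
        rw [lintegral_mul_const, ← lintegral_indicator_one (hslice y)]
        · rfl
        · exact (measurable_one.indicator hS).comp
            (hev.measurable.comp measurable_prodMk_right)
    _ = ∫⁻ U, ∫⁻ y, S.indicator 1 ((U : E →L[ℂ] E) y)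
          * ENNReal.ofReal (Real.exp (-‖y‖ ^ 2)) ∂ν ∂P := by
        refine lintegral_lintegral_swap (Measurable.aemeasurable ?_)
        refine Measurable.mul ?_ (hw.comp measurable_fst)
        exact ((measurable_one.indicator hS).comp hev.measurable).comp measurable_swap
    _ = ∫⁻ _U, ∫⁻ y in S, ENNReal.ofReal (Real.exp (-‖y‖ ^ 2)) ∂ν ∂P := by
        refine lintegral_congr fun U => ?_
        let L := Unitary.linearIsometryEquiv U
        have hL : ∀ z, (U : E →L[ℂ] E) z = L z := fun z => rfl
        rw [← lintegral_indicator hS,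
          ← (L.measurePreserving_addHaar ν).lintegral_comp (hw.indicator hS)]
        refine lintegral_congr fun y => ?_
        rw [hL]
        by_cases h : L y ∈ S <;> simp [h]
    _ = ∫⁻ y in S, ENNReal.ofReal (Real.exp (-‖y‖ ^ 2)) ∂ν := by simp

end UnitaryOrbits

/-! ### Gaussian integrals over `ℂ^ι` -/

section Gaussian

theorem integrable_exp_neg_mul_sq_norm_complex {b : ℝ} (hb : 0 < b) :
    Integrable fun z : ℂ => Real.exp (-b * ‖z‖ ^ 2) := by
  have h := GaussianFourier.integral_rexp_neg_mul_sq_norm (V := ℂ) hb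
  -- A non-integrable function has integral 0 by convention, while the known value is positive.
  by_contra hn
  rw [integral_undef hn] at h
  have : 0 < (Real.pi / b) ^ ((finrank ℝ ℂ : ℝ) / 2) := by positivity
  exact this.ne h

theorem integral_exp_neg_mul_sq_norm_complex {b : ℝ} (hb : 0 < b) :
    ∫ z : ℂ, Real.exp (-b * ‖z‖ ^ 2) = Real.pi / b := by
  rw [GaussianFourier.integral_rexp_neg_mul_sq_norm hb, Complex.finrank_real_complex]
  norm_num

theorem lintegral_exp_neg_sum_mul_sq_norm {ι : Type*} [Fintype ι] (b : ι → ℝ)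
    (hb : ∀ i, 0 < b i) :
    ∫⁻ z : ι → ℂ, ENNReal.ofReal (Real.exp (-∑ i, b i * ‖z i‖ ^ 2))
      = ENNReal.ofReal (∏ i, Real.pi / b i) := by
  have hprod : (fun z : ι → ℂ => Real.exp (-∑ i, b i * ‖z i‖ ^ 2))
      = fun z => ∏ i, Real.exp (-b i * ‖z i‖ ^ 2) := by
    ext z
    rw [← Real.exp_sum, ← Finset.sum_neg_distrib]
    simp
  have hint : Integrable fun z : ι → ℂ => Real.exp (-∑ i, b i * ‖z i‖ ^ 2) := by
    rw [hprod]
    exact Integrable.fintype_prod fun i => integrable_exp_neg_mul_sq_norm_complex (hb i)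
  rw [← ofReal_integral_eq_lintegral_ofReal hint (.of_forall fun z => (Real.exp_pos _).le), hprod,
    integral_fintype_prod_volume_eq_prod fun i (z : ℂ) => Real.exp (-b i * ‖z‖ ^ 2)]
  simp_rw [integral_exp_neg_mul_sq_norm_complex (hb _)]

/-- Lebesgue measure on `ℂ^ι`. -/
noncomputable def complexVolume (ι : Type*) [Fintype ι] : Measure (EuclideanSpace ℂ ι) :=
  (volume : Measure (ι → ℂ)).map (EuclideanSpace.equiv ι ℂ).symm

instance (ι : Type*) [Fintype ι] : (complexVolume ι).IsAddHaarMeasure :=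
  (EuclideanSpace.equiv ι ℂ).symm.isAddHaarMeasure_map volume

theorem lintegral_complexVolume_exp_neg_sum_mul_sq_norm {ι : Type*} [Fintype ι] (b : ι → ℝ)
    (hb : ∀ i, 0 < b i) :
    ∫⁻ y, ENNReal.ofReal (Real.exp (-∑ i, b i * ‖y i‖ ^ 2)) ∂complexVolume ι
      = ENNReal.ofReal (∏ i, Real.pi / b i) := by
  rw [complexVolume, lintegral_map (by fun_prop) (by fun_prop)]
  exact lintegral_exp_neg_sum_mul_sq_norm b hb

end Gaussian

/-! ### Contractions and their Chernoff bound -/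

section Contraction

variable {a b : Type*} [Fintype b]

/-- The contraction of `y ∈ ℂ^a ⊗ ℂ^b` against `φ ∈ ℂ^b` with respect to the bilinear pairing
of `ℂ^b` with itself. -/
noncomputable def tensorContract (y : EuclideanSpace ℂ (a × b)) (φ : EuclideanSpace ℂ b) :
    EuclideanSpace ℂ a :=
  WithLp.toLp 2 fun i => ∑ j, y (i, j) * φ j

@[simp]
theorem tensorContract_apply (y : EuclideanSpace ℂ (a × b)) (φ : EuclideanSpace ℂ b) (i : a) :
    tensorContract y φ i = ∑ j, y (i, j) * φ j := rfl

theorem tensorContract_add_left (y z : EuclideanSpace ℂ (a × b)) (φ : EuclideanSpace ℂ b) :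
    tensorContract (y + z) φ = tensorContract y φ + tensorContract z φ := by
  ext i; simp [add_mul, Finset.sum_add_distrib]

theorem tensorContract_add_right (y : EuclideanSpace ℂ (a × b)) (φ χ : EuclideanSpace ℂ b) :
    tensorContract y (φ + χ) = tensorContract y φ + tensorContract y χ := by
  ext i; simp [mul_add, Finset.sum_add_distrib]

theorem tensorContract_smul_left (c : ℂ) (y : EuclideanSpace ℂ (a × b))
    (φ : EuclideanSpace ℂ b) : tensorContract (c • y) φ = c • tensorContract y φ := by
  ext i; simp [Finset.mul_sum, mul_assoc]

theorem tensorContract_smul_right (c : ℂ) (y : EuclideanSpace ℂ (a × b))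
    (φ : EuclideanSpace ℂ b) : tensorContract y (c • φ) = c • tensorContract y φ := by
  ext i; simp [Finset.mul_sum, mul_left_comm]

theorem continuous_tensorContract_left (φ : EuclideanSpace ℂ b) :
    Continuous fun y : EuclideanSpace ℂ (a × b) => tensorContract y φ := by
  unfold tensorContract
  fun_prop

variable [Fintype a]

theorem norm_sq_eq_sum_rows (y : EuclideanSpace ℂ (a × b)) :
    ‖y‖ ^ 2 = ∑ i, ‖(WithLp.toLp 2 fun j => y (i, j) : EuclideanSpace ℂ b)‖ ^ 2 := by
  simp [EuclideanSpace.norm_sq_eq, Fintype.sum_prod_type]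

theorem norm_tensorContract_le (y : EuclideanSpace ℂ (a × b)) (φ : EuclideanSpace ℂ b) :
    ‖tensorContract y φ‖ ≤ ‖y‖ * ‖φ‖ := by
  refine le_of_sq_le_sq ?_ (by positivity)
  rw [mul_pow, norm_sq_eq_sum_rows, EuclideanSpace.norm_sq_eq, Finset.sum_mul]
  refine Finset.sum_le_sum fun i _ => ?_
  rw [← mul_pow]
  have h := norm_inner_le_norm (𝕜 := ℂ)
    (WithLp.toLp 2 fun j => star (φ j) : EuclideanSpace ℂ b) (WithLp.toLp 2 fun j => y (i, j))
  have hn : ‖(WithLp.toLp 2 fun j => star (φ j) : EuclideanSpace ℂ b)‖ = ‖φ‖ := by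
    simp [EuclideanSpace.norm_eq]
  rw [hn, mul_comm] at h
  gcongr
  simpa [PiLp.inner_apply] using h

/-- An isometry of `ℂ^b` applied to the second factor of `ℂ^a ⊗ ℂ^b`. -/
noncomputable def rightIsometry (a : Type*) [Fintype a]
    (R : EuclideanSpace ℂ b ≃ₗᵢ[ℂ] EuclideanSpace ℂ b) :
    EuclideanSpace ℂ (a × b) ≃ₗᵢ[ℂ] EuclideanSpace ℂ (a × b) :=
  LinearIsometry.toLinearIsometryEquiv
    { toFun := fun y => WithLp.toLp 2 fun p => R (WithLp.toLp 2 fun j => y (p.1, j)) p.2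
      map_add' := fun y z => by
        ext p
        exact congrArg (fun v : EuclideanSpace ℂ b => v p.2)
          (R.map_add (WithLp.toLp 2 fun j => y (p.1, j)) (WithLp.toLp 2 fun j => z (p.1, j)))
      map_smul' := fun c y => by
        ext p
        exact congrArg (fun v : EuclideanSpace ℂ b => v p.2)
          (R.map_smul c (WithLp.toLp 2 fun j => y (p.1, j)))
      norm_map' := fun y => by
        refine (sq_eq_sq₀ (norm_nonneg _) (norm_nonneg _)).1 ?_
        rw [norm_sq_eq_sum_rows y, norm_sq_eq_sum_rows]
        exact Finset.sum_congr rfl fun i _ =>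
          congrArg (· ^ 2) (R.norm_map (WithLp.toLp 2 fun j => y (i, j))) } rfl

theorem rightIsometry_apply (R : EuclideanSpace ℂ b ≃ₗᵢ[ℂ] EuclideanSpace ℂ b)
    (y : EuclideanSpace ℂ (a × b)) (i : a) (j : b) :
    rightIsometry a R y (i, j) = R (WithLp.toLp 2 fun j => y (i, j)) j := rfl

/-- Rotating the conjugate of `φ` to a multiple of the basis vector at `j₀` turns the contraction
into one block of coordinates. -/
theorem exists_linearIsometryEquiv_norm_tensorContract [DecidableEq b] (φ : EuclideanSpace ℂ b)
    (j₀ : b) : ∃ L : EuclideanSpace ℂ (a × b) ≃ₗᵢ[ℂ] EuclideanSpace ℂ (a × b),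
      ∀ y, ‖tensorContract y φ‖ ^ 2 = ‖φ‖ ^ 2 * ∑ i, ‖L y (i, j₀)‖ ^ 2 := by
  let φ' : EuclideanSpace ℂ b := WithLp.toLp 2 fun j => star (φ j)
  have hφ' : ‖φ'‖ = ‖φ‖ := by simp [EuclideanSpace.norm_eq, φ']
  obtain ⟨R, hR⟩ := exists_linearIsometryEquiv_apply_eq
    (x := φ') (y := EuclideanSpace.single j₀ (‖φ‖ : ℂ)) (by simp [hφ'])
  refine ⟨rightIsometry a R, fun y => ?_⟩
  rw [EuclideanSpace.norm_sq_eq, Finset.mul_sum]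
  refine Finset.sum_congr rfl fun i _ => ?_
  have h := R.inner_map_map φ' (WithLp.toLp 2 fun j => y (i, j))
  rw [hR, EuclideanSpace.inner_single_left] at h
  have h2 : tensorContract y φ i = inner ℂ φ' (WithLp.toLp 2 fun j => y (i, j)) := by
    simp [PiLp.inner_apply, φ']
  rw [h2, ← h, rightIsometry_apply]
  simp [mul_pow]

/-- Chernoff bound for the squared length of a contraction of a Gaussian vector. -/
theorem setLIntegral_gaussian_tensorContract_le [DecidableEq b] {φ : EuclideanSpace ℂ b}
    (hφ : φ ≠ 0) (j₀ : b) {t q : ℝ} (ht : 0 ≤ t) (h₁ : 0 < 1 + t * q - t)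
    (h₂ : 0 < 1 + t * q) :
    ∫⁻ y in {y : EuclideanSpace ℂ (a × b) | q * ‖φ‖ ^ 2 * ‖y‖ ^ 2 ≤ ‖tensorContract y φ‖ ^ 2},
        ENNReal.ofReal (Real.exp (-‖y‖ ^ 2)) ∂complexVolume (a × b)
      ≤ ENNReal.ofReal
          (((1 + t * q - t) * (1 + t * q) ^ (Fintype.card b - 1))⁻¹ ^ Fintype.card a)
        * ∫⁻ y, ENNReal.ofReal (Real.exp (-‖y‖ ^ 2)) ∂complexVolume (a × b) := by
  obtain ⟨L, hL⟩ := exists_linearIsometryEquiv_norm_tensorContract (a := a) φ j₀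
  have hφ2 : 0 < ‖φ‖ ^ 2 := by positivity
  let w : a × b → ℝ := fun p => if p.2 = j₀ then 1 + t * q - t else 1 + t * q
  have hw : ∀ p, 0 < w p := fun p => by dsimp only [w]; split_ifs <;> assumption
  have hsum : ∀ y : EuclideanSpace ℂ (a × b),
      ∑ p, w p * ‖y p‖ ^ 2 = (1 + t * q) * ‖y‖ ^ 2 - t * ∑ i, ‖y (i, j₀)‖ ^ 2 := fun y => by
    have : ∀ p : a × b, w p * ‖y p‖ ^ 2
        = (1 + t * q) * ‖y p‖ ^ 2 - t * if p.2 = j₀ then ‖y p‖ ^ 2 else 0 := fun p => by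
      dsimp only [w]; split_ifs <;> ring
    simp_rw [this, Finset.sum_sub_distrib, ← Finset.mul_sum, EuclideanSpace.norm_sq_eq,
      Fintype.sum_prod_type]
    simp
  have hone := lintegral_complexVolume_exp_neg_sum_mul_sq_norm (ι := a × b) (fun _ => 1)
    fun _ => one_pos
  simp only [one_mul, ← EuclideanSpace.norm_sq_eq, div_one] at hone
  -- On the event, the exponent gains `t (‖contraction‖² / ‖φ‖² - q ‖y‖²) ≥ 0`. The tilted form is
  -- diagonal in the rotated coordinates, with weights `w`, so its full integral is explicit.
  calc _ ≤ ∫⁻ y in {y : EuclideanSpace ℂ (a × b) |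
            q * ‖φ‖ ^ 2 * ‖y‖ ^ 2 ≤ ‖tensorContract y φ‖ ^ 2},
          ENNReal.ofReal (Real.exp (-∑ p, w p * ‖L y p‖ ^ 2)) ∂complexVolume (a × b) := by
        refine setLIntegral_mono (by fun_prop) fun y hy => ?_
        gcongr
        rw [hsum, L.norm_map]
        rw [mem_ofPred_eq, hL, mul_right_comm, mul_comm] at hy
        have := le_of_mul_le_mul_left hy hφ2
        nlinarith
    _ ≤ ∫⁻ y, ENNReal.ofReal (Real.exp (-∑ p, w p * ‖L y p‖ ^ 2)) ∂complexVolume (a × b) :=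
        setLIntegral_le_lintegral _ _
    _ = ENNReal.ofReal (∏ p, Real.pi / w p) := by
        rw [← lintegral_complexVolume_exp_neg_sum_mul_sq_norm w hw]
        exact (L.measurePreserving_addHaar (complexVolume (a × b))).lintegral_comp
          (f := fun y => ENNReal.ofReal (Real.exp (-∑ p, w p * ‖y p‖ ^ 2))) (by fun_prop)
    _ = _ := by
        rw [hone, ← ENNReal.ofReal_mul (by positivity)]
        congr 1
        have hw' : ∏ p, w p
            = ((1 + t * q - t) * (1 + t * q) ^ (Fintype.card b - 1)) ^ Fintype.card a := by
          have hrow : ∏ j : b, (if j = j₀ then 1 + t * q - t else 1 + t * q)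
              = (1 + t * q - t) * (1 + t * q) ^ (Fintype.card b - 1) := by
            rw [← Finset.mul_prod_erase _ _ (Finset.mem_univ j₀), if_pos rfl,
              Finset.prod_congr rfl fun j hj => if_neg (Finset.ne_of_mem_erase hj)]
            simp [Finset.card_erase_of_mem]
          simp only [Fintype.prod_prod_type, w, hrow, Finset.prod_const, Finset.card_univ]
        rw [Finset.prod_div_distrib, hw', inv_pow]
        field_simp

end Contraction

/-! ### Tail bound for one pair of vectors -/

section TailBound

theorem one_add_mul_exp_neg_le {δ : ℝ} (h0 : 0 ≤ δ) (h1 : δ ≤ 1 / 2) :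
    (1 + δ) * Real.exp (-δ) ≤ Real.exp (-(δ ^ 2 / 3)) := by
  have hx : 0 ≤ δ - δ ^ 2 / 3 := by nlinarith
  have h := Real.quadratic_le_exp_of_nonneg hx
  have h2 : 1 + δ ≤ Real.exp (δ - δ ^ 2 / 3) := by
    refine le_trans ?_ h
    -- The condition `δ ≤ 1/2` just suffices: `(5/6)²/2 = 25/72 > 1/3`.
    have : 0 ≤ δ ^ 2 * ((1 - δ / 3) ^ 2 / 2 - 1 / 3) := by
      refine mul_nonneg (sq_nonneg _) ?_
      nlinarith
    nlinarith
  calc (1 + δ) * Real.exp (-δ) ≤ Real.exp (δ - δ ^ 2 / 3) * Real.exp (-δ) := by gcongr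
    _ = Real.exp (-(δ ^ 2 / 3)) := by rw [← Real.exp_add]; ring_nf

/-- The Chernoff bound at its optimal parameter. -/
theorem chernoff_factor_le {δ : ℝ} (h0 : 0 < δ) (h1 : δ ≤ 1 / 2) {d : ℕ} (hd : 3 ≤ d) :
    ∃ t : ℝ, 0 ≤ t ∧ 0 < 1 + t * ((1 + δ) / d) - t ∧ 0 < 1 + t * ((1 + δ) / d) ∧
      ((1 + t * ((1 + δ) / d) - t) * (1 + t * ((1 + δ) / d)) ^ (d - 1))⁻¹
        ≤ Real.exp (-(δ ^ 2 / 3)) := by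
  have hd' : (3 : ℝ) ≤ d := by exact_mod_cast hd
  have hD : 0 < (d : ℝ) - 1 - δ := by linarith
  refine ⟨δ * d / ((1 + δ) * (d - 1 - δ)), by positivity, ?_⟩
  have hA : 1 + δ * d / ((1 + δ) * (d - 1 - δ)) * ((1 + δ) / d)
      - δ * d / ((1 + δ) * (d - 1 - δ)) = (1 + δ)⁻¹ := by
    field_simp
    ring
  have hB : 1 + δ * d / ((1 + δ) * (d - 1 - δ)) * ((1 + δ) / d)
      = (1 - δ / (d - 1))⁻¹ := by
    have : (d : ℝ) - 1 ≠ 0 := by linarith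
    rw [one_sub_div this, inv_div]
    field_simp
    ring
  have hC : 0 < 1 - δ / ((d : ℝ) - 1) := by
    have : (0 : ℝ) < d - 1 := by linarith
    rw [sub_pos, div_lt_one this]; linarith
  rw [hA, hB]
  refine ⟨by positivity, by positivity, ?_⟩
  rw [mul_inv, inv_inv, inv_pow, inv_inv]
  refine le_trans ?_ (one_add_mul_exp_neg_le h0.le h1)
  gcongr
  have hcast : ((d - 1 : ℕ) : ℝ) = d - 1 := by
    rw [Nat.cast_sub (by omega)]; simp
  calc (1 - δ / ((d : ℝ) - 1)) ^ (d - 1)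
      ≤ Real.exp (-(δ / ((d : ℝ) - 1))) ^ (d - 1) := by
        gcongr
        exact Real.one_sub_le_exp_neg _
    _ = Real.exp (-δ) := by
        rw [← Real.exp_nat_mul, hcast]
        congr 1
        have : (d : ℝ) - 1 ≠ 0 := by linarith
        field_simp

variable {a b : Type*} [Fintype a] [Fintype b] [DecidableEq b]

/-- Under a suitable distribution on the unitaries of `ℂ^a ⊗ ℂ^b`, the image of a fixed vector
rarely has a contraction that is much longer than the average one. -/
theorem exists_unitary_distribution_tensorContract {δ : ℝ} (h0 : 0 < δ) (h1 : δ ≤ 1 / 2)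
    (hb : 3 ≤ Fintype.card b) :
    ∃ (_ : MeasurableSpace
          (unitary (EuclideanSpace ℂ (a × b) →L[ℂ] EuclideanSpace ℂ (a × b))))
      (_ : BorelSpace (unitary (EuclideanSpace ℂ (a × b) →L[ℂ] EuclideanSpace ℂ (a × b))))
      (P : Measure (unitary (EuclideanSpace ℂ (a × b) →L[ℂ] EuclideanSpace ℂ (a × b)))),
      IsProbabilityMeasure P ∧
        ∀ (x : EuclideanSpace ℂ (a × b)) (φ : EuclideanSpace ℂ b), x ≠ 0 → φ ≠ 0 →
          P {U | (1 + δ) / Fintype.card b * ‖φ‖ ^ 2 * ‖x‖ ^ 2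
              ≤ ‖tensorContract
                ((U : EuclideanSpace ℂ (a × b) →L[ℂ] EuclideanSpace ℂ (a × b)) x) φ‖ ^ 2}
            ≤ ENNReal.ofReal (Real.exp (-(Fintype.card a * (δ ^ 2 / 3)))) := by
  obtain ⟨m, hB, P, hP, hS⟩ := exists_unitary_distribution (complexVolume (a × b))
  refine ⟨m, hB, P, hP, fun x φ hx hφ => ?_⟩
  obtain ⟨t, ht, ht1, ht2, hle⟩ := chernoff_factor_le h0 h1 hb
  obtain ⟨j₀⟩ : Nonempty b := Fintype.card_pos_iff.1 (by omega)
  have hgauss := lintegral_complexVolume_exp_neg_sum_mul_sq_norm (ι := a × b) (fun _ => 1)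
    fun _ => one_pos
  simp only [one_mul, ← EuclideanSpace.norm_sq_eq, div_one] at hgauss
  have hbound := setLIntegral_gaussian_tensorContract_le (a := a) hφ j₀ ht ht1 ht2
  rw [← hS _ ?_ ?_ x hx] at hbound
  · have hbound' := (ENNReal.mul_le_mul_iff_left ?_ ?_).1 hbound
    -- Replacing `‖x‖` by `‖U x‖` turns the event into membership of `U x` in a cone.
    · have hset : {U : unitary (EuclideanSpace ℂ (a × b) →L[ℂ] EuclideanSpace ℂ (a × b)) |
          (1 + δ) / Fintype.card b * ‖φ‖ ^ 2 * ‖x‖ ^ 2 ≤ ‖tensorContract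
            ((U : EuclideanSpace ℂ (a × b) →L[ℂ] EuclideanSpace ℂ (a × b)) x) φ‖ ^ 2}
          = {U : unitary (EuclideanSpace ℂ (a × b) →L[ℂ] EuclideanSpace ℂ (a × b)) |
            (U : EuclideanSpace ℂ (a × b) →L[ℂ] EuclideanSpace ℂ (a × b)) x ∈
              {y | (1 + δ) / Fintype.card b * ‖φ‖ ^ 2 * ‖y‖ ^ 2 ≤ ‖tensorContract y φ‖ ^ 2}} := by
        ext U
        have hU : ‖(U : EuclideanSpace ℂ (a × b) →L[ℂ] EuclideanSpace ℂ (a × b)) x‖ = ‖x‖ :=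
          (Unitary.linearIsometryEquiv U).norm_map x
        simp only [mem_ofPred_eq, hU]
      rw [hset]
      refine hbound'.trans (ENNReal.ofReal_le_ofReal ?_)
      rw [← mul_neg, Real.exp_nat_mul]
      gcongr
    · rw [hgauss, Ne, ENNReal.ofReal_eq_zero, not_le]
      positivity
    · rw [hgauss]
      exact ENNReal.ofReal_ne_top
  · exact (isClosed_le (by fun_prop)
      ((continuous_tensorContract_left φ).norm.pow 2)).measurableSet
  · intro c y hc
    have hc' : 0 < ‖c‖ ^ 2 := by positivity
    simp only [mem_ofPred_eq, tensorContract_smul_left, norm_smul, mul_pow]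
    rw [mul_left_comm, mul_le_mul_iff_right₀ hc']

end TailBound

/-! ### Nets on complex spheres -/

section Nets

theorem abs_sub_mul_round_div_le {h : ℝ} (hh : 0 < h) (r : ℝ) :
    |r - h * round (r / h)| ≤ h / 2 := by
  have h1 := abs_sub_round (r / h)
  have h2 : r - h * round (r / h) = h * (r / h - round (r / h)) := by field_simp
  rw [h2, abs_mul, abs_of_pos hh]
  nlinarith

theorem round_mem_Icc_neg_floor {ρ r : ℝ} (hr : |r| ≤ ρ) :
    round r ∈ Finset.Icc (-(⌊ρ + 1 / 2⌋₊ : ℤ)) ⌊ρ + 1 / 2⌋₊ := by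
  have hρ : 0 ≤ ρ + 1 / 2 := by linarith [abs_nonneg r]
  have h1 := abs_sub_le_iff.1 (abs_sub_round r)
  have h2 := abs_le.1 hr
  rw [Finset.mem_Icc, Int.natCast_floor_eq_floor hρ]
  constructor
  · rw [neg_le, Int.le_floor]
    push_cast
    linarith
  · rw [Int.le_floor]
    linarith

/-- The unit sphere of `ℂ^ι` has a finite `η`-net of nonzero vectors, with an explicit bound
on its size. -/
theorem exists_finset_net (ι : Type*) [Fintype ι] [Nonempty ι] {η : ℝ} (hη : 0 < η)
    (hη1 : η < 1) :
    ∃ T : Finset (EuclideanSpace ℂ ι),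
      (∀ x : EuclideanSpace ℂ ι, ‖x‖ = 1 → ∃ y ∈ T, ‖x - y‖ ≤ η) ∧ (∀ y ∈ T, y ≠ 0) ∧
        (T.card : ℝ) ≤ (2 * Fintype.card ι / η + 2) ^ (2 * Fintype.card ι) := by
  classical
  have hm : (1 : ℝ) ≤ Fintype.card ι := by exact_mod_cast Fintype.card_pos (α := ι)
  set m : ℝ := (Fintype.card ι : ℝ)
  -- With mesh `η / m`, rounding real and imaginary parts costs at most `h²` per coordinate, hence
  -- `η² / m` in total. Net points need not be unit vectors.
  let h : ℝ := η / m
  have hh : 0 < h := by positivity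
  let K : ℕ := ⌊m / η + 1 / 2⌋₊
  let I : Finset ℤ := Finset.Icc (-(K : ℤ)) K
  let g : (ι → ℤ × ℤ) → EuclideanSpace ℂ ι := fun f =>
    WithLp.toLp 2 fun i => ⟨h * (f i).1, h * (f i).2⟩
  refine ⟨((Fintype.piFinset fun _ : ι => I ×ˢ I).image g).filter (· ≠ 0), fun x hx => ?_,
    fun y hy => (Finset.mem_filter.1 hy).2, ?_⟩
  · let f : ι → ℤ × ℤ := fun i => (round ((x i).re / h), round ((x i).im / h))
    have hdist : ‖x - g f‖ ≤ η := by
      refine le_of_sq_le_sq ?_ hη.le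
      rw [EuclideanSpace.norm_sq_eq]
      have hi : ∀ i, ‖(x - g f) i‖ ^ 2 ≤ h ^ 2 := fun i => by
        have hre := sq_le_sq.2 ((abs_sub_mul_round_div_le hh (x i).re).trans (le_abs_self _))
        have him := sq_le_sq.2 ((abs_sub_mul_round_div_le hh (x i).im).trans (le_abs_self _))
        rw [Complex.sq_norm, Complex.normSq_apply]
        simp only [PiLp.sub_apply, g, f, Complex.sub_re, Complex.sub_im]
        nlinarith
      calc ∑ i, ‖(x - g f) i‖ ^ 2 ≤ ∑ _i : ι, h ^ 2 := Finset.sum_le_sum fun i _ => hi i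
        _ = η ^ 2 / m := by
          rw [Finset.sum_const, Finset.card_univ, nsmul_eq_mul]
          change m * (η / m) ^ 2 = _
          field_simp
        _ ≤ η ^ 2 := div_le_self (sq_nonneg _) hm
    refine ⟨g f, Finset.mem_filter.2 ⟨Finset.mem_image_of_mem g ?_, ?_⟩, hdist⟩
    · rw [Fintype.mem_piFinset]
      intro i
      have hxi : ‖x i‖ ≤ 1 := hx ▸ PiLp.norm_apply_le x i
      have hbd : ∀ r : ℝ, |r| ≤ 1 → round (r / h) ∈ I := fun r hr => by
        refine round_mem_Icc_neg_floor ?_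
        rw [abs_div, abs_of_pos hh, div_le_iff₀ hh]
        have : m / η * h = 1 := by simp only [h]; field_simp
        rwa [this]
      exact Finset.mem_product.2 ⟨hbd _ ((Complex.abs_re_le_norm _).trans hxi),
        hbd _ ((Complex.abs_im_le_norm _).trans hxi)⟩
    -- Discarding 0 is harmless: it has distance `1 > η` from the sphere.
    · intro h0
      rw [h0, sub_zero, hx] at hdist
      linarith
  · have hcard : ((Fintype.piFinset fun _ : ι => I ×ˢ I).image g).card
        ≤ (2 * K + 1) ^ (2 * Fintype.card ι) := by
      refine Finset.card_image_le.trans (le_of_eq ?_)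
      have hI : I.card = 2 * K + 1 := by simp only [I, Int.card_Icc]; omega
      rw [Fintype.card_piFinset, Finset.prod_const, Finset.card_product, hI, Finset.card_univ,
        pow_mul, sq]
    have hK : (K : ℝ) ≤ m / η + 1 / 2 := Nat.floor_le (by positivity)
    calc _ ≤ (((2 * K + 1) ^ (2 * Fintype.card ι) : ℕ) : ℝ) := by
            exact_mod_cast (Finset.card_filter_le _ _).trans hcard
      _ = (2 * (K : ℝ) + 1) ^ (2 * Fintype.card ι) := by push_cast; rfl
      _ ≤ (2 * m / η + 2) ^ (2 * Fintype.card ι) := by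
            gcongr ?_ ^ _
            rw [mul_div_assoc]
            linarith

end Nets

/-! ### Choosing the samples -/

section FirstMoment

variable {Ω κ : Type*} [MeasurableSpace Ω] (P : Measure Ω) [IsProbabilityMeasure P]

/-- Method of conditional expectations: each new sample is chosen to keep the weighted sum at or
below its mean, so no product measure is needed. -/
theorem exists_sum_prod_le_pow_mul_card (T : Finset κ) (w : κ → Ω → ℝ≥0∞) {C : ℝ≥0∞}
    (hw : ∀ j ∈ T, Measurable (w j)) (hC : ∀ j ∈ T, ∫⁻ ω, w j ω ∂P ≤ C) (n : ℕ) :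
    ∃ ω : Fin n → Ω, ∑ j ∈ T, ∏ k, w j (ω k) ≤ C ^ n * T.card := by
  induction n with
  | zero => exact ⟨Fin.elim0, by simp⟩
  | succ n ih =>
    obtain ⟨ω, hω⟩ := ih
    obtain ⟨ω₀, hω₀⟩ := exists_le_lintegral (μ := P)
      (f := fun x => ∑ j ∈ T, w j x * ∏ k, w j (ω k))
      (Finset.measurable_fun_sum _ fun j hj => (hw j hj).mul_const _).aemeasurable
    refine ⟨Fin.cons ω₀ ω, ?_⟩
    simp only [Fin.prod_univ_succ, Fin.cons_zero, Fin.cons_succ]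
    calc _ ≤ ∫⁻ x, ∑ j ∈ T, w j x * ∏ k, w j (ω k) ∂P := hω₀
      _ = ∑ j ∈ T, (∫⁻ x, w j x ∂P) * ∏ k, w j (ω k) := by
        rw [lintegral_finsetSum' _ fun j hj => ((hw j hj).mul_const _).aemeasurable]
        exact Finset.sum_congr rfl fun j hj => lintegral_mul_const _ (hw j hj)
      _ ≤ ∑ j ∈ T, C * ∏ k, w j (ω k) :=
        Finset.sum_le_sum fun j hj => mul_le_mul_left (hC j hj) _
      _ ≤ C * (C ^ n * T.card) := by
        rw [← Finset.mul_sum]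
        gcongr
      _ = C ^ (n + 1) * T.card := by ring

open Classical in
/-- Finitely many rare events: some sequence of samples hits each of them only a few times. -/
theorem exists_forall_pow_card_le (T : Finset κ) (A : κ → Set Ω) (M : ℕ)
    (hA : ∀ j ∈ T, MeasurableSet (A j)) (hM : ∀ j ∈ T, M * P (A j) ≤ 1) (n : ℕ) :
    ∃ ω : Fin n → Ω, ∀ j ∈ T,
      M ^ (Finset.univ.filter fun k => ω k ∈ A j).card ≤ 2 ^ n * T.card := by
  -- The weight `1 + M·1_A` has mean at most 2, and its product over the samples is at least `M` to
  -- the number of hits.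
  obtain ⟨ω, hω⟩ := exists_sum_prod_le_pow_mul_card P T
    (fun j x => 1 + (A j).indicator (fun _ => (M : ℝ≥0∞)) x) (C := 2)
    (fun j hj => measurable_const.add (measurable_const.indicator (hA j hj)))
    (fun j hj => by
      rw [lintegral_add_left measurable_const, lintegral_indicator_const (hA j hj)]
      simp only [lintegral_const, measure_univ, mul_one]
      calc (1 : ℝ≥0∞) + M * P (A j) ≤ 1 + 1 := by gcongr; exact hM j hj
        _ = 2 := by norm_num) n
  refine ⟨ω, fun j hj => ?_⟩
  have h1 : (M : ℝ≥0∞) ^ (Finset.univ.filter fun k => ω k ∈ A j).card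
      ≤ ∏ k, (1 + (A j).indicator (fun _ => (M : ℝ≥0∞)) (ω k)) := by
    rw [← Finset.prod_const, Finset.prod_filter]
    refine Finset.prod_le_prod' fun k _ => ?_
    by_cases hk : ω k ∈ A j <;> simp [hk]
  have h2 := (h1.trans (Finset.single_le_sum (f := fun j =>
    ∏ k, (1 + (A j).indicator (fun _ => (M : ℝ≥0∞)) (ω k))) (fun _ _ => zero_le) hj)).trans hω
  exact_mod_cast h2

end FirstMoment

/-! ### From contractions to the reduced state -/

section PartialTrace

variable {a b : Type*} [Fintype a] [Fintype b]

open Matrix.Norms.L2Operator in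
-- The reduced state is `Z† Z`, with `Z` the conjugated coefficient matrix of `U ψ`; the C*-identity
-- gives its norm as `‖Z‖²`.
theorem norm_partialTraceA_pureState_le [DecidableEq a] [DecidableEq b] {ι : Type*} [Fintype ι]
    (U : EuclideanSpace ℂ ι →ₗᵢ[ℂ] EuclideanSpace ℂ (a × b)) (ψ : EuclideanSpace ℂ ι) {s : ℝ}
    (hs : 0 ≤ s) (h : ∀ φ, ‖tensorContract (U ψ) φ‖ ≤ s * ‖φ‖) :
    ‖partialTraceA (conjIsometry U (pureState ψ))‖ ≤ s ^ 2 := by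
  let Z : Matrix a b ℂ := Matrix.of fun i j => star (U ψ (i, j))
  have hM : (Matrix.of fun j j' : b => ∑ i : a,
      conjIsometry U (pureState ψ) (EuclideanSpace.single (i, j') 1) (i, j))
      = Z.conjTranspose * Z := by
    ext j j'
    rw [Matrix.mul_apply, Matrix.of_apply]
    refine Finset.sum_congr rfl fun i _ => ?_
    simp only [conjIsometry, pureState, ContinuousLinearMap.comp_apply,
      InnerProductSpace.rankOne_apply, ContinuousLinearMap.adjoint_inner_right, map_smul]
    simp [Z, EuclideanSpace.inner_single_right, mul_comm]
  have hZ : ‖Z‖ ≤ s := by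
    rw [Matrix.l2_opNorm_def]
    refine ContinuousLinearMap.opNorm_le_bound _ hs fun φ => ?_
    have h1 := h (WithLp.toLp 2 fun j => star (φ j))
    have h2 : ‖(WithLp.toLp 2 fun j => star (φ j) : EuclideanSpace ℂ b)‖ = ‖φ‖ := by
      simp [EuclideanSpace.norm_eq]
    have h3 : ‖(WithLp.toLp 2 (Z.mulVec φ) : EuclideanSpace ℂ a)‖
        = ‖tensorContract (U ψ) (WithLp.toLp 2 fun j => star (φ j))‖ := by
      rw [EuclideanSpace.norm_eq, EuclideanSpace.norm_eq]
      congr 1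
      refine Finset.sum_congr rfl fun i _ => congrArg (· ^ 2) ?_
      rw [← norm_star]
      simp [Z, Matrix.mulVec, dotProduct, mul_comm]
    rw [h2, ← h3] at h1
    exact h1
  rw [partialTraceA, hM, Matrix.l2_opNorm_toEuclideanCLM, Matrix.l2_opNorm_conjTranspose_mul_self,
    sq]
  gcongr

/-- A bound on the contractions against a net extends to all vectors. -/
theorem norm_tensorContract_le_of_net (y : EuclideanSpace ℂ (a × b))
    (T : Finset (EuclideanSpace ℂ b)) {η s : ℝ} (hη : 0 ≤ η) (hη1 : η < 1) (hs : 0 ≤ s)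
    (hT : ∀ φ : EuclideanSpace ℂ b, ‖φ‖ = 1 → ∃ χ ∈ T, ‖φ - χ‖ ≤ η)
    (h : ∀ χ ∈ T, ‖tensorContract y χ‖ ≤ s * ‖χ‖) (φ : EuclideanSpace ℂ b) :
    ‖tensorContract y φ‖ ≤ s * (1 + η) / (1 - η) * ‖φ‖ := by
  let C : EuclideanSpace ℂ b →L[ℂ] EuclideanSpace ℂ a :=
    LinearMap.mkContinuous
      { toFun := tensorContract y
        map_add' := tensorContract_add_right y
        map_smul' := fun c φ => tensorContract_smul_right c y φ } ‖y‖ (norm_tensorContract_le y)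
  have hC : ∀ φ, C φ = tensorContract y φ := fun _ => rfl
  have hunit : ∀ φ : EuclideanSpace ℂ b, ‖φ‖ = 1 → ‖C φ‖ ≤ s * (1 + η) + ‖C‖ * η := fun φ hφ => by
    obtain ⟨χ, hχ, hφχ⟩ := hT φ hφ
    have h1 : ‖χ‖ ≤ 1 + η := by
      have := norm_sub_norm_le χ φ
      rw [norm_sub_rev] at this
      linarith
    calc ‖C φ‖ = ‖C χ + C (φ - χ)‖ := by rw [← map_add]; simp
      _ ≤ ‖C χ‖ + ‖C (φ - χ)‖ := norm_add_le _ _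
      _ ≤ s * (1 + η) + ‖C‖ * η := by
        refine add_le_add ((h χ hχ).trans ?_) ((C.le_opNorm _).trans ?_) <;> gcongr
  -- The norm is bounded in terms of itself; `η < 1` lets it be solved for.
  have hK : ‖C‖ ≤ s * (1 + η) + ‖C‖ * η := by
    refine C.opNorm_le_bound (by positivity) fun φ => ?_
    rcases eq_or_ne φ 0 with rfl | hφ
    · simp
    have hφ' : ‖φ‖ ≠ 0 := norm_ne_zero_iff.2 hφ
    have := hunit ((‖φ‖ : ℂ)⁻¹ • φ) (by simp [norm_smul, hφ'])
    rw [map_smul, norm_smul, norm_inv, Complex.norm_real, norm_norm,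
      inv_mul_le_iff₀ (by positivity)] at this
    linarith
  have hK' : ‖C‖ ≤ s * (1 + η) / (1 - η) := by
    rw [le_div_iff₀ (by linarith)]
    linarith
  rw [← hC]
  exact (C.le_opNorm φ).trans (by gcongr)

/-- A coordinate embedding of a smaller space into a larger one. -/
theorem exists_linearIsometry_of_card_le {ι κ : Type*} [Fintype ι] [Fintype κ]
    (h : Fintype.card ι ≤ Fintype.card κ) :
    Nonempty (EuclideanSpace ℂ ι →ₗᵢ[ℂ] EuclideanSpace ℂ κ) := by
  obtain ⟨e⟩ := Function.Embedding.nonempty_of_card_le h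
  let u := EuclideanSpace.basisFun ι ℂ
  let v := EuclideanSpace.basisFun κ ℂ
  refine ⟨LinearMap.isometryOfOrthonormal (u.toBasis.constr ℂ (v ∘ e)) (v := u.toBasis)
    (by simp) ?_⟩
  have : (u.toBasis.constr ℂ (v ∘ e)) ∘ u.toBasis = v ∘ e := by
    ext1 i
    simp only [Function.comp_apply, Basis.constr_basis]
  rw [this]
  exact v.orthonormal.comp e e.injective

end PartialTrace

/-! ### Constants -/

section Numerics

theorem one_le_log_of_ten_le {x : ℝ} (hx : 10 ≤ x) : 1 ≤ Real.log x := by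
  rw [Real.le_log_iff_exp_le (by linarith)]
  linarith [Real.exp_one_lt_d9]

/-- The error from moving `ψ` is absolute, so its net has radius of order `ε/d`, compared with `√q`
through `1/d ≤ √q`. All losses together cost a factor `1 + ε/8`, and `(1 + ε/2)(1 + ε/8)² < 1 + ε`.
-/
theorem net_bound_sq_lt {ε q η : ℝ} {d : ℝ} (hε0 : 0 < ε) (hε1 : ε ≤ 1) (hd : 10 ≤ d)
    (hq : q = (1 + ε / 2) / d) (hη : η = ε / 40) :
    (√q * (1 + ε / (40 * d)) * (1 + η) / (1 - η) + ε / (40 * d)) ^ 2 < (1 + ε) / d := by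
  have hq0 : 0 < q := by rw [hq]; positivity
  have hη1 : 0 < 1 - η := by rw [hη]; linarith
  have hη0 : 0 < η := by rw [hη]; positivity
  have hdq : 1 / d ≤ √q := by
    refine Real.le_sqrt_of_sq_le ?_
    rw [hq, div_pow, one_pow, div_le_div_iff₀ (by positivity) (by positivity)]
    nlinarith
  have hsmall : ε / (40 * d) ≤ ε / 40 * √q := by
    calc ε / (40 * d) = ε / 40 * (1 / d) := by field_simp
      _ ≤ ε / 40 * √q := by gcongr
  have hsmall' : ε / (40 * d) ≤ ε / 400 := by gcongr; linarith
  have hfrac : (1 + η) / (1 - η) ≤ 1 + 3 * η := by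
    rw [div_le_iff₀ (by rw [hη]; linarith), hη]
    nlinarith
  have hmain : √q * (1 + ε / (40 * d)) * (1 + η) / (1 - η) + ε / (40 * d)
      ≤ √q * (1 + ε / 8) := by
    have h1 : √q * (1 + ε / (40 * d)) * (1 + η) / (1 - η)
        ≤ √q * ((1 + ε / 400) * (1 + 3 * (ε / 40))) := by
      rw [mul_div_assoc, mul_assoc, ← hη]
      gcongr
    have h2 : (1 + ε / 400) * (1 + 3 * (ε / 40)) + ε / 40 ≤ 1 + ε / 8 := by nlinarith
    nlinarith [Real.sqrt_nonneg q]
  calc (√q * (1 + ε / (40 * d)) * (1 + η) / (1 - η) + ε / (40 * d)) ^ 2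
      ≤ (√q * (1 + ε / 8)) ^ 2 := by gcongr
    _ = (1 + ε / 2) * (1 + ε / 8) ^ 2 / d := by rw [mul_pow, Real.sq_sqrt hq0.le, hq]; ring
    _ < (1 + ε) / d := by
      gcongr
      nlinarith [mul_pos hε0 hε0, mul_pos (mul_pos hε0 hε0) hε0,
        mul_nonneg hε0.le (sub_nonneg.2 hε1), mul_nonneg (mul_pos hε0 hε0).le (sub_nonneg.2 hε1)]

theorem small_net_card_le {ε : ℝ} {d : ℕ} (hε0 : 0 < ε) (hd : 10 / ε ≤ d) (hd10 : (10 : ℝ) ≤ d) :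
    (2 * (d : ℝ) / (ε / 40) + 2) ^ (2 * d) ≤ (d : ℝ) ^ (6 * d) := by
  have h : 2 * (d : ℝ) / (ε / 40) + 2 ≤ (d : ℝ) ^ 3 := by
    have : 2 * (d : ℝ) / (ε / 40) = 8 * d * (10 / ε) := by field_simp; norm_num
    rw [this]
    have h2 : (1 : ℝ) ≤ (d : ℝ) ^ 2 := one_le_pow₀ (by linarith)
    have h3 : (10 : ℝ) * d ^ 2 ≤ d * d ^ 2 := by gcongr
    nlinarith [mul_le_mul_of_nonneg_left hd (show (0 : ℝ) ≤ 8 * d by positivity)]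
  calc _ ≤ ((d : ℝ) ^ 3) ^ (2 * d) := by gcongr
    _ = _ := by rw [← pow_mul]; congr 1; ring

theorem large_net_card_le {ε : ℝ} {d : ℕ} (hε0 : 0 < ε) (hd : 10 / ε ≤ d) (hd10 : (10 : ℝ) ≤ d) :
    (2 * ((d ^ 2 : ℕ) : ℝ) / (ε / (40 * d)) + 2) ^ (2 * d ^ 2) ≤ (d : ℝ) ^ (10 * d ^ 2) := by
  have h : 2 * ((d ^ 2 : ℕ) : ℝ) / (ε / (40 * d)) + 2 ≤ (d : ℝ) ^ 5 := by
    have : 2 * ((d ^ 2 : ℕ) : ℝ) / (ε / (40 * d)) = 8 * d ^ 3 * (10 / ε) := by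
      push_cast; field_simp; norm_num
    rw [this]
    have h4 : (1 : ℝ) ≤ (d : ℝ) ^ 4 := one_le_pow₀ (by linarith)
    have h5 : (10 : ℝ) * d ^ 4 ≤ d * d ^ 4 := by gcongr
    nlinarith [mul_le_mul_of_nonneg_left hd (show (0 : ℝ) ≤ 8 * d ^ 3 by positivity)]
  calc _ ≤ ((d : ℝ) ^ 5) ^ (2 * d ^ 2) := by gcongr
    _ = _ := by rw [← pow_mul]; congr 1; ring

/-- The exponent `8d` is `6d` for the net plus `2d` for the bad-sample weight. The excess of
`112/12` over 8 absorbs the rounding of `d_A`. -/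
theorem pow_mul_exp_neg_le_one {ε : ℝ} {d dA : ℕ} (hε0 : 0 < ε) (hε1 : ε ≤ 1)
    (hd10 : (10 : ℝ) ≤ d)
    (hdA : 112 / ε ^ 2 * (d * Real.log d) - 1 < (dA : ℝ)) :
    (d : ℝ) ^ (8 * d) * Real.exp (-(dA * ((ε / 2) ^ 2 / 3))) ≤ 1 := by
  have hL := one_le_log_of_ten_le hd10
  have hd0 : (0 : ℝ) < d := by linarith
  have hpow : (d : ℝ) ^ (8 * d) = Real.exp (8 * (d * Real.log d)) := by
    rw [← Real.exp_log (pow_pos hd0 _), Real.log_pow]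
    push_cast
    ring_nf
  rw [hpow, ← Real.exp_add, Real.exp_le_one_iff]
  have h1 : 112 * (d * Real.log d) - ε ^ 2 ≤ dA * ε ^ 2 := by
    have := mul_le_mul_of_nonneg_right hdA.le (sq_nonneg ε)
    have h2 : (112 / ε ^ 2 * (d * Real.log d) - 1) * ε ^ 2
        = 112 * (d * Real.log d) - ε ^ 2 := by field_simp
    rwa [h2] at this
  have h3 : (10 : ℝ) ≤ d * Real.log d := by nlinarith
  nlinarith

/-- Taking logarithms gives `2dc ln d ≤ n ln 2 + 10d² ln d`. Each term on the right is at most `εn·d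
ln d`: the first because `dε ≥ 10`, the second because `εn ≥ 10d`. -/
theorem card_le_of_pow_le {ε : ℝ} {d n c : ℕ} (hε0 : 0 < ε) (hε1 : ε ≤ 1) (hd : 10 / ε ≤ d)
    (hd10 : (10 : ℝ) ≤ d) (hn : 120 / ε ^ 3 * (d * Real.log d) - 1 < (n : ℝ))
    (hc : ((d : ℝ) ^ (2 * d)) ^ c ≤ 2 ^ n * (d : ℝ) ^ (10 * d ^ 2)) : (c : ℝ) ≤ ε * n := by
  have hL := one_le_log_of_ten_le hd10
  have hd0 : (0 : ℝ) < d := by linarith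
  have hlog := Real.log_le_log (by positivity) hc
  rw [Real.log_mul (by positivity) (by positivity)] at hlog
  simp only [Real.log_pow] at hlog
  push_cast at hlog
  set ℓ := Real.log d
  have h1 : 120 * (d * ℓ) - ε ^ 3 ≤ n * ε ^ 3 := by
    have := mul_le_mul_of_nonneg_right hn.le (show 0 ≤ ε ^ 3 by positivity)
    have h2 : (120 / ε ^ 3 * (d * ℓ) - 1) * ε ^ 3 = 120 * (d * ℓ) - ε ^ 3 := by field_simp
    rwa [h2] at this
  have hε3 : ε ^ 3 ≤ ε := by
    calc ε ^ 3 ≤ ε ^ 1 := pow_le_pow_of_le_one hε0.le hε1 (by norm_num)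
      _ = ε := pow_one ε
  have hdε : 10 ≤ d * ε := by rwa [div_le_iff₀ hε0] at hd
  have hlog2 : Real.log 2 ≤ 1 := by linarith [Real.log_two_lt_d9]
  have hn0 : (0 : ℝ) ≤ n := Nat.cast_nonneg n
  have h4 : 10 * (d : ℝ) ≤ ε * n := by
    have : (n : ℝ) * ε ^ 3 ≤ n * ε := by gcongr
    nlinarith
  by_contra hcon
  push Not at hcon
  have h5 : (n : ℝ) * Real.log 2 ≤ d * ℓ * (ε * n) := by
    have : (n : ℝ) * Real.log 2 ≤ n * 1 := by gcongr
    have h6 : 10 * ℓ ≤ d * ε * ℓ := by gcongr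
    nlinarith
  have h7 : 10 * (d : ℝ) ^ 2 * ℓ ≤ d * ℓ * (ε * n) := by
    have : (d * ℓ) * (10 * (d : ℝ)) ≤ d * ℓ * (ε * n) := by gcongr
    nlinarith
  have h8 : d * ℓ * (ε * n) < d * ℓ * c := by gcongr
  nlinarith

end Numerics

/-! ### Assembly of the random construction -/

theorem lemma1 (ε : ℝ) (hε0 : 0 < ε) (hε1 : ε ≤ 1) (d : ℕ) (hd : 10 / ε ≤ (d : ℝ))
    -- `n` and `dA` are the real numbers of the statement rounded, up or down, to integers
    (n dA : ℕ)
    (hn : |(n : ℝ) - 120 * Real.log 2 / ε ^ 3 * (d * Real.logb 2 d)| < 1)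
    (hdA : |(dA : ℝ) - 112 * Real.log 2 / ε ^ 2 * (d * Real.logb 2 d)| < 1) :
    ∃ U : Fin n → (EuclideanSpace ℂ (Fin (d ^ 2)) →ₗᵢ[ℂ] EuclideanSpace ℂ (Fin dA × Fin d)),
      ∀ ψ : EuclideanSpace ℂ (Fin (d ^ 2)), ‖ψ‖ = 1 →
        1 - ε ≤
          ({k : Fin n | ‖partialTraceA (conjIsometry (U k) (pureState ψ))‖ < (1 + ε) / d}.ncard : ℝ)
            / n := by
  classical
  have hd10 : (10 : ℝ) ≤ d := by
    refine le_trans ?_ hd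
    rw [le_div_iff₀ hε0]
    linarith
  have hd10' : 10 ≤ d := by exact_mod_cast hd10
  have hd0 : (0 : ℝ) < d := by linarith
  have hL := one_le_log_of_ten_le hd10
  have hlogb : ∀ x y : ℝ, x * Real.log 2 / y * (d * Real.logb 2 d) = x / y * (d * Real.log d) :=
    fun x y => by
      have h2 : Real.log 2 ≠ 0 := (Real.log_pos one_lt_two).ne'
      rw [Real.logb]
      field_simp
  rw [hlogb] at hn hdA
  have hn' : 120 / ε ^ 3 * (d * Real.log d) - 1 < (n : ℝ) := by linarith [(abs_lt.1 hn).1]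
  have hdA' : 112 / ε ^ 2 * (d * Real.log d) - 1 < (dA : ℝ) := by linarith [(abs_lt.1 hdA).1]
  have hdL : (d : ℝ) ≤ d * Real.log d := le_mul_of_one_le_right hd0.le hL
  have hn0 : (0 : ℝ) < n := by
    have : (120 : ℝ) ≤ 120 / ε ^ 3 :=
      le_div_self (by norm_num) (by positivity) (pow_le_one₀ hε0.le hε1)
    nlinarith
  have hdAd : d ≤ dA := by
    have : (112 : ℝ) ≤ 112 / ε ^ 2 :=
      le_div_self (by norm_num) (by positivity) (pow_le_one₀ hε0.le hε1)
    have : (d : ℝ) ≤ dA := by nlinarith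
    exact_mod_cast this
  have : Nonempty (Fin d) := ⟨⟨0, by omega⟩⟩
  have : Nonempty (Fin (d ^ 2)) := ⟨⟨0, by positivity⟩⟩
  obtain ⟨J⟩ := exists_linearIsometry_of_card_le (ι := Fin (d ^ 2)) (κ := Fin dA × Fin d)
    (by simpa [sq] using Nat.mul_le_mul_right d hdAd)
  obtain ⟨T, hT, hT0, hTcard⟩ := exists_finset_net (Fin (d ^ 2)) (η := ε / (40 * d))
    (by positivity) (by rw [div_lt_one (by positivity)]; linarith)
  obtain ⟨T', hT', hT'0, hT'card⟩ := exists_finset_net (Fin d) (η := ε / 40)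
    (by positivity) (by linarith)
  rw [Fintype.card_fin] at hTcard hT'card
  have hTcard' := hTcard.trans (large_net_card_le hε0 hd hd10)
  have hT'card' := hT'card.trans (small_net_card_le hε0 hd hd10)
  obtain ⟨_, _, P, _, hP⟩ := exists_unitary_distribution_tensorContract (a := Fin dA)
    (b := Fin d) (δ := ε / 2) (by positivity) (by linarith) (by simp; omega)
  simp only [Fintype.card_fin] at hP
  set q : ℝ := (1 + ε / 2) / d with hq
  let V := EuclideanSpace ℂ (Fin dA × Fin d)
  -- The unitaries that are bad for `ψ`: some contraction against the small net is too long.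
  let A : EuclideanSpace ℂ (Fin (d ^ 2)) → Set (unitary (V →L[ℂ] V)) := fun ψ =>
    ⋃ φ ∈ T', {U | q * ‖φ‖ ^ 2 * ‖J ψ‖ ^ 2 ≤ ‖tensorContract ((U : V →L[ℂ] V) (J ψ)) φ‖ ^ 2}
  obtain ⟨ω, hω⟩ := exists_forall_pow_card_le P T A (d ^ (2 * d))
    (fun ψ _ => T'.measurableSet_biUnion fun φ _ => by
      refine (isClosed_le continuous_const (Continuous.pow (Continuous.norm ?_) 2)).measurableSet
      exact (continuous_tensorContract_left φ).comp
        (continuous_subtype_val.clm_apply continuous_const))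
    (fun ψ hψ => by
      have hJψ : J ψ ≠ 0 := by
        simpa using (map_ne_zero_iff J J.injective).2 (hT0 ψ hψ)
      calc ((d ^ (2 * d) : ℕ) : ℝ≥0∞) * P (A ψ)
          ≤ (d ^ (2 * d) : ℕ) * (T'.card *
              ENNReal.ofReal (Real.exp (-(dA * ((ε / 2) ^ 2 / 3))))) := by
            gcongr
            refine (measure_biUnion_finset_le _ _).trans ?_
            rw [← nsmul_eq_mul]
            exact Finset.sum_le_card_nsmul _ _ _ fun φ hφ => hP _ _ hJψ (hT'0 φ hφ)
        _ = ENNReal.ofReal ((d : ℝ) ^ (2 * d) *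
              (T'.card * Real.exp (-(dA * ((ε / 2) ^ 2 / 3))))) := by
            rw [ENNReal.ofReal_mul (by positivity), ENNReal.ofReal_mul (by positivity),
              ENNReal.ofReal_natCast, ← Nat.cast_pow, ENNReal.ofReal_natCast]
        _ ≤ 1 := by
            rw [← ENNReal.ofReal_one]
            refine ENNReal.ofReal_le_ofReal (le_trans ?_
              (pow_mul_exp_neg_le_one hε0 hε1 hd10 hdA'))
            calc (d : ℝ) ^ (2 * d) * (T'.card * Real.exp (-(dA * ((ε / 2) ^ 2 / 3))))
                ≤ (d : ℝ) ^ (2 * d) *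
                  ((d : ℝ) ^ (6 * d) * Real.exp (-(dA * ((ε / 2) ^ 2 / 3)))) := by gcongr
              _ = _ := by
                rw [← mul_assoc, ← pow_add]
                congr 2
                ring) n
  refine ⟨fun k => (Unitary.linearIsometryEquiv (ω k)).toLinearIsometry.comp J, fun ψ hψ => ?_⟩
  -- Bad indices are counted at the net point; a sample good for `ψ'` satisfies the final bound at
  -- `ψ`.
  obtain ⟨ψ', hψ'T, hψψ'⟩ := hT ψ hψ
  have hbad : ((Finset.univ.filter fun k => ω k ∈ A ψ').card : ℝ) ≤ ε * n := by
    refine card_le_of_pow_le hε0 hε1 hd hd10 hn' ?_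
    have h1 : (((d ^ (2 * d)) ^ (Finset.univ.filter fun k => ω k ∈ A ψ').card : ℕ) : ℝ)
        ≤ ((2 ^ n * T.card : ℕ) : ℝ) := by exact_mod_cast hω ψ' hψ'T
    push_cast at h1
    exact h1.trans (by gcongr)
  have hgood : ∀ k, ω k ∉ A ψ' →
      ‖partialTraceA (conjIsometry ((Unitary.linearIsometryEquiv (ω k)).toLinearIsometry.comp J)
        (pureState ψ))‖ < (1 + ε) / d := fun k hk => by
    set W := (Unitary.linearIsometryEquiv (ω k)).toLinearIsometry.comp J
    have hψ'norm : ‖ψ'‖ ≤ 1 + ε / (40 * d) := by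
      have := norm_sub_norm_le ψ' ψ
      rw [norm_sub_rev] at this
      linarith
    have hnet : ∀ χ ∈ T', ‖tensorContract (W ψ') χ‖ ≤ √q * (1 + ε / (40 * d)) * ‖χ‖ :=
      fun χ hχ => by
        have h1 : ‖tensorContract (W ψ') χ‖ ^ 2 < q * ‖χ‖ ^ 2 * ‖J ψ'‖ ^ 2 := by
          by_contra hcon
          exact hk (mem_biUnion hχ (not_lt.1 hcon))
        rw [J.norm_map] at h1
        refine (Real.le_sqrt_of_sq_le h1.le).trans ?_
        rw [Real.sqrt_mul (by positivity), Real.sqrt_mul (by positivity),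
          Real.sqrt_sq (norm_nonneg _), Real.sqrt_sq (norm_nonneg _), mul_right_comm]
        gcongr
    have hall := norm_tensorContract_le_of_net (W ψ') T' (by positivity) (by linarith)
      (by positivity) hT' hnet
    have hη1 : 0 < 1 - ε / 40 := by linarith
    refine (norm_partialTraceA_pureState_le W ψ (s := √q * (1 + ε / (40 * d)) * (1 + ε / 40)
      / (1 - ε / 40) + ε / (40 * d)) (by positivity) fun φ => ?_).trans_lt
      (net_bound_sq_lt hε0 hε1 hd10 hq rfl)
    calc ‖tensorContract (W ψ) φ‖
        = ‖tensorContract (W ψ') φ + tensorContract (W (ψ - ψ')) φ‖ := by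
          rw [← tensorContract_add_left, ← map_add, add_sub_cancel]
      _ ≤ ‖tensorContract (W ψ') φ‖ + ‖tensorContract (W (ψ - ψ')) φ‖ := norm_add_le _ _
      _ ≤ √q * (1 + ε / (40 * d)) * (1 + ε / 40) / (1 - ε / 40) * ‖φ‖
          + ε / (40 * d) * ‖φ‖ := by
          refine add_le_add (hall φ) ((norm_tensorContract_le _ _).trans ?_)
          rw [W.norm_map]
          gcongr
      _ = _ := by ring
  rw [le_div_iff₀ hn0]
  have hsub : (((Finset.univ.filter fun k => ω k ∉ A ψ') : Finset (Fin n)) : Set (Fin n)) ⊆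
      {k : Fin n | ‖partialTraceA (conjIsometry
        ((Unitary.linearIsometryEquiv (ω k)).toLinearIsometry.comp J) (pureState ψ))‖
          < (1 + ε) / d} := fun k hk => hgood k (by simpa using hk)
  have hcard := Set.ncard_le_ncard hsub (Set.toFinite _)
  rw [Set.ncard_coe_finset] at hcard
  have hsum := Finset.card_filter_add_card_filter_not (s := (Finset.univ : Finset (Fin n)))
    (fun k => ω k ∈ A ψ')
  rw [Finset.card_univ, Fintype.card_fin] at hsum
  have hsum' : ((Finset.univ.filter fun k => ω k ∈ A ψ').card : ℝ)
      + (Finset.univ.filter fun k => ω k ∉ A ψ').card = n := by exact_mod_cast hsum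
  have hcard' : ((Finset.univ.filter fun k => ω k ∉ A ψ').card : ℝ) ≤ _ := Nat.cast_le.2 hcard
  linarith
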